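/- **Almost sure asymptotic synchronization.** Let $N\ge 2$, $\alpha,\beta\in[0,1)$ with $\alpha+\beta\in(0,1)$, $q\in(0,1]$, let $f:[0,1]\to[0,1]$ be strictly increasing and of class $C^1$ on $[0,1]$, and let $(r_n)_{n\ge 0}$ be real numbers with $\lim_{n\to\infty} n\,r_n=1$. On a probability space let $Z_{n,h}$ ($n\ge0$, $1\le h\le N$) be random variables with values in $[0,1]$ and $I_{n,h}$ ($n\ge1$, $1\le h\le N$) random variables with values in $\{0,1\}$ such that, with $\mathcal F_n=\sigma(Z_{0,h},\,I_{k,h}:1\le k\le n,\,1\le h\le N)$ and $Z_n=\frac1N\sum_{i=1}^N Z_{n,i}$, for all $n\ge 0$ the variables $I_{n+1,1},\dots,I_{n+1,N}$ are conditionally independent given $\mathcal F_n$ and, for all $h$, $$P(I_{n+1,h}=1\mid\mathcal F_n)=\alpha Z_n+\beta q+(1-\alpha-\beta)f(Z_{n,h})\ \text{ a.s.},\qquad Z_{n+1,h}=(1-r_n)Z_{n,h}+r_nI_{n+1,h}.$$ Put $\mathbf Z_n=(Z_{n,1},\dots,Z_{n,N})$, $\mathbf 1=(1,\dots,1)$,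 $\mathbf F(\mathbf z)=(F_1(\mathbf z),\dots,F_N(\mathbf z))$ with $$F_h(\mathbf z)=\frac{\alpha}{N}\sum_{i=1}^N z_i+\beta q+(1-\alpha-\beta)f(z_h)-z_h,\qquad \mathbf z\in[0,1]^N,$$ and $\mathcal Z(\mathbf F)=\{\mathbf z\in[0,1]^N:\mathbf F(\mathbf z)=\mathbf 0\}$. Call a point of $\mathcal Z(\mathbf F)$ of the form $z\mathbf 1$, $z\in[0,1]$, a synchronization point. Assume that $\mathcal Z(\mathbf F)$ contains only finitely many synchronization points, that $f$ has a primitive on $[0,1]$, and that for every $c\in\left(-\frac{\alpha+\beta}{1-\alpha-\beta},0\right)$ the function $$\widetilde\varphi(z)=f(z)-\frac{1}{1-\alpha-\beta}\,z-c$$ has at most one zero in $[0,1]$; in the degenerate case where both $\alpha=0$ and $q=1$, assume this also for the left endpoint $c=-\frac{\alpha+\beta}{1-\alpha-\beta}$. Then every point of $\mathcal Z(\mathbf F)$ is a synchronization point, and there is a random variable $Z_\infty$ with values in $[0,1]$ such that $\mathbf Z_n\to Z_\infty\mathbf 1$ almost surely and $$\varphi(Z_\infty)=f(Z_\infty)-\frac{1-\alpha}{1-\alpha-\beta}\,Z_\infty+\frac{\beta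 q}{1-\alpha-\beta}=0 .$$ -/

import Mathlib

open MeasureTheory ProbabilityTheory Filter Topology Set

namespace ReinforcedSync

/-- The components of `X` are conditionally independent given the σ-field `m`: for all finite
families of components and all Borel sets, the conditional probability of the intersection is
almost surely the product of the conditional probabilities. -/
def CondIndepGiven {Ω : Type*} [MeasurableSpace Ω] (μ : Measure Ω) {N : ℕ}
    (m : MeasurableSpace Ω) (X : Fin N → Ω → ℝ) : Prop :=
  ∀ (s : Finset (Fin N)) (B : Fin N → Set ℝ), (∀ h, MeasurableSet (B h)) →
    μ⟦⋂ h ∈ s, X h ⁻¹' B h|m⟧ =ᵐ[μ] ∏ h ∈ s, μ⟦X h ⁻¹' B h|m⟧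

/-- The past information up to time `n`: the σ-field generated by the initial states `Z 0 h`
and by the actions `I k h` with `1 ≤ k ≤ n`. -/
abbrev past {Ω : Type*} {N : ℕ} (I Z : ℕ → Fin N → Ω → ℝ) (n : ℕ) : MeasurableSpace Ω :=
  (⨆ h, MeasurableSpace.comap (Z 0 h) inferInstance) ⊔
    ⨆ k ∈ Set.Icc 1 n, ⨆ h, MeasurableSpace.comap (I k h) inferInstance

/-- The arithmetic mean of the components of a vector. -/
noncomputable def avg {N : ℕ} (z : Fin N → ℝ) : ℝ := (∑ i, z i) / N

/-- The interacting system of reinforced stochastic processes on `(Ω, μ)`, with `N` units,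
parameters `α`, `β`, `q`, reinforcement function `f`, weights `r`, actions `I n h` (for `n ≥ 1`;
`I 0 h` plays no role) and states `Z n h` (for `n ≥ 0`). -/
structure IsSystem {Ω : Type*} [MeasurableSpace Ω] (μ : Measure Ω) {N : ℕ} (α β q : ℝ)
    (f : ℝ → ℝ) (r : ℕ → ℝ) (I Z : ℕ → Fin N → Ω → ℝ) : Prop where
  measurable_init : ∀ h, Measurable (Z 0 h)
  measurable_action : ∀ n h, Measurable (I (n + 1) h)
  /-- the actions take values in `{0, 1}` -/
  action_mem : ∀ n h ω, I (n + 1) h ω = 0 ∨ I (n + 1) h ω = 1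
  /-- the states take values in `[0, 1]` -/
  state_mem : ∀ n h ω, Z n h ω ∈ Icc (0 : ℝ) 1
  /-- `r n ∼ 1 / n` -/
  weights : Tendsto (fun n : ℕ => (n : ℝ) * r n) atTop (𝓝 1)
  dynamics : ∀ n h ω, Z (n + 1) h ω = (1 - r n) * Z n h ω + r n * I (n + 1) h ω
  condIndep : ∀ n, CondIndepGiven μ (past I Z n) (I (n + 1))
  condProb : ∀ n h, μ⟦I (n + 1) h ⁻¹' {1}|past I Z n⟧ =ᵐ[μ]
    fun ω => α * avg (fun i => Z n i ω) + β * q + (1 - α - β) * f (Z n h ω)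

/-- The mean vector field `F` of the system. -/
noncomputable def field (N : ℕ) (α β q : ℝ) (f : ℝ → ℝ) (z : Fin N → ℝ) : Fin N → ℝ :=
  fun h => α * avg z + β * q + (1 - α - β) * f (z h) - z h

/-- The zero set of `F` in `[0, 1] ^ N`. -/
def zeroSet (N : ℕ) (α β q : ℝ) (f : ℝ → ℝ) : Set (Fin N → ℝ) :=
  {z | (∀ h, z h ∈ Icc (0 : ℝ) 1) ∧ field N α β q f z = 0}

/-- The synchronized vectors, that is those of the form `(t, …, t)` with `t ∈ [0, 1]`. -/
def IsSynchronized {N : ℕ} (z : Fin N → ℝ) : Prop :=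
  ∃ t ∈ Icc (0 : ℝ) 1, z = fun _ => t

/-- The function `φ` whose zeros give the synchronized zeros of `F`. -/
noncomputable def syncFun (α β q : ℝ) (f : ℝ → ℝ) (z : ℝ) : ℝ :=
  f z - (1 - α) / (1 - α - β) * z + β * q / (1 - α - β)

/-- The function `z ↦ f z - z / (1 - α - β) - c` has at most one zero in `[0, 1]`. -/
def AtMostOneZero (α β : ℝ) (f : ℝ → ℝ) (c : ℝ) : Prop :=
  {z | z ∈ Icc (0 : ℝ) 1 ∧ f z - 1 / (1 - α - β) * z - c = 0}.Subsingleton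

end ReinforcedSync

/-! The field `F` is minus the gradient of a potential `V`. As `f` is increasing, `½ |z| ^ 2` is the
only summand of `V` which is not concave, so that
`V w ≤ V z - F z ⬝ᵥ (w - z) + ½ |w - z| ^ 2`. Along `Z (n + 1) = Z n + r n • (F (Z n) + ξ n)` the
martingales `∑ r n • ξ n` and `∑ r n * (F (Z n) ⬝ᵥ ξ n)` converge almost surely, whence
`∑ r n * |F (Z n)| ^ 2 < ∞`. Since `∑ r n = ∞`, it follows that `F (Z n) → 0`, and `Z n` approaches
the zero set of `F`, all of whose points are synchronized. Finally, the mean of `Z n`, corrected by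
the accumulated noise, moves only when the mean of `F (Z n)` is nonzero: it stays put on intervals
of zeros of `φ` and eventually avoids intervals without zeros. Hence it cannot oscillate.
-/

namespace ReinforcedSync

theorem exists_Icc_subset_or_subset_compl_of_isClosed {T : Set ℝ} (hT : IsClosed T) {s t : ℝ}
    (hst : s < t) :
    ∃ a b, s ≤ a ∧ a < b ∧ b ≤ t ∧ (Icc a b ⊆ T ∨ Icc a b ⊆ Tᶜ) := by
  by_cases hsub : Ioo s t ⊆ T
  · exact ⟨s, t, le_rfl, hst, le_rfl,
      .inl (closure_Ioo hst.ne ▸ closure_minimal hsub hT)⟩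
  · obtain ⟨p, hp, hpT⟩ := not_subset.1 hsub
    obtain ⟨a, b, -, hnhds, hab⟩ := exists_Icc_mem_subset_of_mem_nhds
      ((isOpen_Ioo.inter hT.isOpen_compl).mem_nhds ⟨hp, hpT⟩)
    obtain ⟨hap, hpb⟩ := Icc_mem_nhds_iff.1 hnhds
    have hab' : a ≤ b := (hap.trans hpb).le
    exact ⟨a, b, (hab ⟨le_rfl, hab'⟩).1.1.le, hap.trans hpb, (hab ⟨hab', le_rfl⟩).1.2.le,
      .inr fun x hx => (hab hx).2⟩

theorem mul_sub_le_integral_of_monotoneOn {f : ℝ → ℝ} {s : Set ℝ} (hs : s.OrdConnected)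
    (hf : MonotoneOn f s) {a b : ℝ} (ha : a ∈ s) (hb : b ∈ s) :
    f a * (b - a) ≤ ∫ x in a..b, f x := by
  have hsub : uIcc a b ⊆ s := hs.uIcc_subset ha hb
  have hint : IntervalIntegrable f volume a b := (hf.mono hsub).intervalIntegrable
  rcases le_total a b with hab | hba
  · calc f a * (b - a) = ∫ _ in a..b, f a := by
          rw [intervalIntegral.integral_const, smul_eq_mul, mul_comm]
      _ ≤ ∫ x in a..b, f x := intervalIntegral.integral_mono_on hab intervalIntegrable_const hint
        fun x hx => hf ha (hs.out ha hb hx) hx.1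
  · have hle : ∫ x in b..a, f x ≤ ∫ _ in b..a, f a :=
      intervalIntegral.integral_mono_on hba hint.symm intervalIntegrable_const
        fun x hx => hf (hs.out hb ha hx) ha hx.2
    rw [intervalIntegral.integral_const, smul_eq_mul] at hle
    rw [intervalIntegral.integral_symm]
    linarith

theorem dotProduct_self_le_card {ι : Type*} [Fintype ι] {v : ι → ℝ} (hv : ∀ i, |v i| ≤ 1) :
    v ⬝ᵥ v ≤ Fintype.card ι := by
  calc v ⬝ᵥ v ≤ ∑ _ : ι, (1 : ℝ) := Finset.sum_le_sum fun i _ => by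
        rw [← sq]; exact (sq_le_one_iff_abs_le_one _).2 (hv i)
    _ = Fintype.card ι := by simp

theorem norm_sq_le_dotProduct_self {ι : Type*} [Fintype ι] (v : ι → ℝ) : ‖v‖ ^ 2 ≤ v ⬝ᵥ v := by
  have hnonneg : 0 ≤ v ⬝ᵥ v := Finset.sum_nonneg fun i _ => mul_self_nonneg (v i)
  refine (Real.le_sqrt (norm_nonneg v) hnonneg).1 ((pi_norm_le_iff_of_nonneg (Real.sqrt_nonneg _)).2
    fun i => Real.abs_le_sqrt ?_)
  rw [sq]
  exact Finset.single_le_sum (f := fun i => v i * v i) (fun i _ => mul_self_nonneg _)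
    (Finset.mem_univ i)

section StochasticApproximation

theorem summable_of_le_sub_add {a v e : ℕ → ℝ} {b : ℝ} (ha : ∀ᶠ n in atTop, 0 ≤ a n)
    (hv : ∀ n, b ≤ v n) (hav : ∀ n, a n ≤ v n - v (n + 1) + e n)
    (he : BddAbove (range fun n => ∑ k ∈ Finset.range n, e k)) : Summable a := by
  obtain ⟨C, hC⟩ := he
  obtain ⟨m, hm⟩ := eventually_atTop.1 ha
  have hsum (n : ℕ) : ∑ k ∈ Finset.range n, a k ≤ v 0 - b + C :=
    calc ∑ k ∈ Finset.range n, a k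
        ≤ ∑ k ∈ Finset.range n, (v k - v (k + 1) + e k) := Finset.sum_le_sum fun k _ => hav k
      _ = v 0 - v n + ∑ k ∈ Finset.range n, e k := by
        rw [Finset.sum_add_distrib, Finset.sum_range_sub']
      _ ≤ v 0 - b + C := by gcongr; exacts [hv n, hC (mem_range_self n)]
  refine (summable_nat_add_iff m).1 (summable_of_sum_range_le
    (c := v 0 - b + C - ∑ k ∈ Finset.range m, a k) (fun k => hm _ (Nat.le_add_left m k))
    fun n => le_sub_iff_add_le'.2 ?_)
  calc ∑ k ∈ Finset.range m, a k + ∑ k ∈ Finset.range n, a (k + m)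
      = ∑ k ∈ Finset.range (m + n), a k := by simp only [Finset.sum_range_add, add_comm _ m]
    _ ≤ v 0 - b + C := hsum _

theorem exists_tendsto_of_forall_exists_barrier {y : ℕ → ℝ}
    (hbdd : Bornology.IsBounded (range y))
    (hstep : Tendsto (fun n => y (n + 1) - y n) atTop (𝓝 0))
    (hbar : ∀ s t, s < t → ∃ a b, s ≤ a ∧ a < b ∧ b ≤ t ∧
      ∀ᶠ n in atTop, y n ∈ Icc a b → y (n + 1) = y n) :
    ∃ l, Tendsto y atTop (𝓝 l) := by
  refine tendsto_of_no_upcrossings dense_univ (fun s _ t _ hst ⟨hs, ht⟩ => ?_)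
    hbdd.bddAbove.isBoundedUnder_of_range hbdd.bddBelow.isBoundedUnder_of_range
  obtain ⟨a, b, hsa, hab, hbt, hstuck⟩ := hbar s t hst
  obtain ⟨m, hm⟩ := eventually_atTop.1
    (hstuck.and (hstep.eventually_lt_const (sub_pos.2 hab)))
  obtain ⟨n, hmn, hns⟩ := frequently_atTop.1 hs m
  have hle : ∀ k ≥ n, y k ≤ b := by
    intro k hk
    induction k, hk using Nat.le_induction with
    | base => linarith
    | succ k hk ih =>
      obtain ⟨hkstuck, hkstep⟩ := hm k (hmn.trans hk)
      by_cases hka : a ≤ y k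
      · exact (hkstuck ⟨hka, ih⟩).trans_le ih
      · linarith
  obtain ⟨k, hk, hkt⟩ := frequently_atTop.1 ht n
  linarith [hle k hk]

theorem tendsto_nhdsSet_inter_preimage {X Y α : Type*} [TopologicalSpace X]
    [TopologicalSpace Y] [T2Space Y] {K : Set X} (hK : IsCompact K) {F : X → Y}
    (hF : ContinuousOn F K) {l : Filter α} {x : α → X} (hx : ∀ n, x n ∈ K) {p : Y}
    (hFx : Tendsto (fun n => F (x n)) l (𝓝 p)) : Tendsto x l (𝓝ˢ (K ∩ F ⁻¹' {p})) := by
  refine (hasBasis_nhdsSet _).tendsto_right_iff.2 fun U ⟨hU, hKU⟩ => ?_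
  have hclosed : IsClosed (F '' (K \ U)) :=
    ((hK.diff hU).image_of_continuousOn (hF.mono sdiff_subset)).isClosed
  have hp : p ∉ F '' (K \ U) := by
    rintro ⟨z, ⟨hzK, hzU⟩, hz⟩
    exact hzU (hKU ⟨hzK, hz⟩)
  filter_upwards [hFx.eventually (hclosed.isOpen_compl.mem_nhds hp)] with n hn
  by_contra hxU
  exact hn ⟨x n, ⟨hx n, hxU⟩, rfl⟩

theorem eventually_forall_norm_sum_range_add_lt {E : Type*} [SeminormedAddCommGroup E]
    {u : ℕ → E} (hu : CauchySeq fun n => ∑ k ∈ Finset.range n, u k) {ε : ℝ} (hε : 0 < ε) :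
    ∀ᶠ n in atTop, ∀ j, ‖∑ k ∈ Finset.range j, u (n + k)‖ < ε := by
  obtain ⟨m, hm⟩ := Metric.cauchySeq_iff.1 hu ε hε
  filter_upwards [eventually_ge_atTop m] with n hn j
  have h := hm (n + j) (hn.trans (Nat.le_add_right n j)) n hn
  rwa [dist_eq_norm, Finset.sum_range_add, add_sub_cancel_left] at h

section NormedSpace

variable {E : Type*} [NormedAddCommGroup E] [NormedSpace ℝ E] {K : Set E} {F : E → E}
  {x ξ : ℕ → E} {r : ℕ → ℝ}

/-- While `κ ≤ ‖F (x k)‖`, the drift `∑ r k ‖F (x k)‖` is at most `κ⁻¹ ∑ r k ‖F (x k)‖ ^ 2`, so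
the sequence has not moved far enough for `‖F (x j)‖` to drop below `κ`. -/
theorem forall_le_norm_of_sum_lt {κ ρ : ℝ} (hκ : 0 < κ)
    (hF : ∀ z ∈ K, ∀ w ∈ K, dist z w < ρ → dist (F z) (F w) < κ) (hx : ∀ n, x n ∈ K)
    (hr : ∀ n, 0 ≤ r n) (hstep : ∀ n, x (n + 1) = x n + r n • (F (x n) + ξ n))
    (hstart : 2 * κ ≤ ‖F (x 0)‖)
    (hdrift : ∀ j, ∑ k ∈ Finset.range j, r k * ‖F (x k)‖ ^ 2 < κ * (ρ / 2))
    (hnoise : ∀ j, ‖∑ k ∈ Finset.range j, r k • ξ k‖ < ρ / 2) (j : ℕ) : κ ≤ ‖F (x j)‖ := by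
  induction j using Nat.strong_induction_on with
  | _ j ih =>
    have hpath : x j - x 0 =
        ∑ k ∈ Finset.range j, r k • F (x k) + ∑ k ∈ Finset.range j, r k • ξ k := by
      rw [← Finset.sum_range_sub, ← Finset.sum_add_distrib]
      simp only [hstep, add_sub_cancel_left, smul_add]
    have hsum : κ * ‖∑ k ∈ Finset.range j, r k • F (x k)‖ < κ * (ρ / 2) := by
      refine lt_of_le_of_lt ?_ (hdrift j)
      grw [norm_sum_le, Finset.mul_sum]
      refine Finset.sum_le_sum fun k hk => ?_
      rw [norm_smul, Real.norm_of_nonneg (hr k), mul_left_comm, sq]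
      gcongr
      exacts [hr k, ih k (Finset.mem_range.1 hk)]
    have hdist : dist (x j) (x 0) < ρ := by
      rw [dist_eq_norm, hpath]
      linarith [norm_add_le (∑ k ∈ Finset.range j, r k • F (x k))
        (∑ k ∈ Finset.range j, r k • ξ k), lt_of_mul_lt_mul_left hsum hκ.le, hnoise j]
    have hclose := hF _ (hx j) _ (hx 0) hdist
    rw [dist_comm, dist_eq_norm] at hclose
    linarith [norm_sub_norm_le (F (x 0)) (F (x j))]

theorem tendsto_field_zero_of_summable_mul_norm_sq (hF : UniformContinuousOn F K)
    (hx : ∀ n, x n ∈ K) (hr : ∀ᶠ n in atTop, 0 ≤ r n) (hr' : ¬ Summable r)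
    (hstep : ∀ n, x (n + 1) = x n + r n • (F (x n) + ξ n))
    (hsum : Summable fun n => r n * ‖F (x n)‖ ^ 2)
    (hξ : CauchySeq fun n => ∑ k ∈ Finset.range n, r k • ξ k) :
    Tendsto (fun n => F (x n)) atTop (𝓝 0) := by
  refine tendsto_zero_iff_norm_tendsto_zero.2 ?_
  by_contra hnot
  obtain ⟨κ, hκ, hlarge⟩ : ∃ κ > 0, ∃ᶠ n in atTop, 2 * κ ≤ ‖F (x n)‖ := by
    by_contra! hcon
    refine hnot (tendsto_order.2 ⟨fun a ha => Eventually.of_forall fun n =>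
      ha.trans_le (norm_nonneg _), fun ε hε => ?_⟩)
    simpa only [mul_div_cancel₀ ε two_ne_zero] using hcon (ε / 2) (half_pos hε)
  obtain ⟨ρ, hρ, hclose⟩ := Metric.uniformContinuousOn_iff.1 hF κ hκ
  have hdrift_tail := eventually_forall_norm_sum_range_add_lt
    hsum.hasSum.tendsto_sum_nat.cauchySeq (mul_pos hκ (half_pos hρ))
  have hnoise_tail := eventually_forall_norm_sum_range_add_lt hξ (half_pos hρ)
  obtain ⟨n, hn, hn0, hdrift, hnoise⟩ := (hlarge.and_eventually
    ((eventually_forall_ge_atTop.2 hr).and (hdrift_tail.and hnoise_tail))).exists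
  have hfar : ∀ j, κ ≤ ‖F (x (n + j))‖ :=
    forall_le_norm_of_sum_lt (r := fun k => r (n + k)) (ξ := fun k => ξ (n + k)) hκ hclose
      (fun j => hx _) (fun j => hn0 _ (Nat.le_add_right n j)) (fun j => hstep _) hn
      (fun j => (le_abs_self _).trans_lt (hdrift j)) hnoise
  have hdom : Summable fun k => κ ^ 2 * r k := by
    refine Summable.of_norm_bounded_eventually_nat hsum ?_
    filter_upwards [eventually_ge_atTop n] with k hk
    obtain ⟨j, rfl⟩ := Nat.exists_eq_add_of_le hk
    have := hn0 _ hk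
    rw [Real.norm_of_nonneg (by positivity), mul_comm]
    gcongr
    exact hfar j
  exact hr' ((summable_mul_left_iff (by positivity)).1 hdom)

end NormedSpace

theorem summable_mul_dotProduct_self_of_lyapunov {ι : Type*} [Fintype ι] {K : Set (ι → ℝ)}
    {F : (ι → ℝ) → ι → ℝ} {V : (ι → ℝ) → ℝ} {b L B : ℝ} (hL : 0 ≤ L) (hVb : ∀ z ∈ K, b ≤ V z)
    (hV : ∀ z ∈ K, ∀ w ∈ K, V w ≤ V z - F z ⬝ᵥ (w - z) + L * ((w - z) ⬝ᵥ (w - z)))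
    {x ξ : ℕ → ι → ℝ} {r : ℕ → ℝ} (hx : ∀ n, x n ∈ K) (hr : ∀ᶠ n in atTop, 0 ≤ r n)
    (hr2 : Summable fun n => r n ^ 2) (hstep : ∀ n, x (n + 1) = x n + r n • (F (x n) + ξ n))
    (hB : ∀ n, (F (x n) + ξ n) ⬝ᵥ (F (x n) + ξ n) ≤ B)
    (hFξ : CauchySeq fun n => ∑ k ∈ Finset.range n, r k * (F (x k) ⬝ᵥ ξ k)) :
    Summable fun n => r n * (F (x n) ⬝ᵥ F (x n)) := by
  have hdescent (n : ℕ) : r n * (F (x n) ⬝ᵥ F (x n)) ≤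
      V (x n) - V (x (n + 1)) + (L * B * r n ^ 2 - r n * (F (x n) ⬝ᵥ ξ n)) := by
    have hVn := hV _ (hx n) _ (hx (n + 1))
    simp only [hstep, add_sub_cancel_left, dotProduct_smul, smul_dotProduct, smul_eq_mul] at hVn
    rw [dotProduct_add] at hVn
    have := mul_le_mul_of_nonneg_left (hB n) (mul_nonneg hL (sq_nonneg (r n)))
    rw [hstep]
    linarith
  refine summable_of_le_sub_add ?_ (fun n => hVb _ (hx n)) hdescent ?_
  · exact hr.mono fun n hn => mul_nonneg hn (by simpa using dotProduct_star_self_nonneg (F (x n)))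
  · obtain ⟨l, hl⟩ := cauchySeq_tendsto_of_complete hFξ
    have hlim := ((hr2.mul_left (L * B)).hasSum.tendsto_sum_nat).sub hl
    simpa only [Finset.sum_sub_distrib] using hlim.bddAbove_range

end StochasticApproximation

section Martingale

variable {Ω : Type*} {m0 : MeasurableSpace Ω} {μ : Measure Ω} [IsFiniteMeasure μ]
  {ℱ : Filtration ℕ m0} {D : ℕ → Ω → ℝ}

theorem martingale_sum_of_condExp_eq_zero (hD : ∀ n, StronglyMeasurable[ℱ (n + 1)] (D n))
    (hint : ∀ n, Integrable (D n) μ) (hcond : ∀ n, μ[D n | ℱ n] =ᵐ[μ] 0) :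
    Martingale (fun n => ∑ k ∈ Finset.range n, D k) ℱ μ := by
  refine martingale_of_condExp_sub_eq_zero_nat
    (fun n => Finset.stronglyMeasurable_sum _ fun k hk =>
      (hD k).mono (ℱ.mono (Finset.mem_range.1 hk)))
    (fun n => integrable_finsetSum' _ fun k _ => hint k) fun n => ?_
  simpa only [Finset.sum_range_succ_sub_sum] using hcond n

theorem integral_mul_eq_zero_of_condExp_eq_zero {m : MeasurableSpace Ω} (hm : m ≤ m0)
    {X Y : Ω → ℝ} (hX : StronglyMeasurable[m] X) (hXY : Integrable (X * Y) μ)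
    (hY : Integrable Y μ) (hcond : μ[Y | m] =ᵐ[μ] 0) : ∫ ω, X ω * Y ω ∂μ = 0 :=
  calc ∫ ω, X ω * Y ω ∂μ = ∫ ω, (μ[X * Y | m]) ω ∂μ := (integral_condExp hm).symm
    _ = ∫ _, 0 ∂μ := integral_congr_ae <| by
      filter_upwards [condExp_mul_of_stronglyMeasurable_left hX hXY hY, hcond] with ω hω hω0
      rw [hω, Pi.mul_apply, hω0, Pi.zero_apply, mul_zero]
    _ = 0 := integral_zero _ _

theorem integral_sum_sq_of_condExp_eq_zero (hD : ∀ n, StronglyMeasurable[ℱ (n + 1)] (D n))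
    (hL2 : ∀ n, MemLp (D n) 2 μ) (hcond : ∀ n, μ[D n | ℱ n] =ᵐ[μ] 0) (n : ℕ) :
    ∫ ω, (∑ k ∈ Finset.range n, D k ω) ^ 2 ∂μ = ∑ k ∈ Finset.range n, ∫ ω, D k ω ^ 2 ∂μ := by
  have hMart := martingale_sum_of_condExp_eq_zero hD (fun n => (hL2 n).integrable one_le_two) hcond
  have hM2 (n : ℕ) : MemLp (∑ k ∈ Finset.range n, D k) 2 μ := memLp_finsetSum' _ fun k _ => hL2 k
  induction n with
  | zero => simp
  | succ n ih =>
    have hcross : ∫ ω, (∑ k ∈ Finset.range n, D k) ω * D n ω ∂μ = 0 :=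
      integral_mul_eq_zero_of_condExp_eq_zero (ℱ.le n) (hMart.stronglyMeasurable n)
        ((hM2 n).integrable_mul (hL2 n)) ((hL2 n).integrable one_le_two) (hcond n)
    have hMD : Integrable (fun ω => (∑ k ∈ Finset.range n, D k) ω * D n ω) μ :=
      (hM2 n).integrable_mul (hL2 n)
    have hM2D : Integrable (fun ω => (∑ k ∈ Finset.range n, D k) ω ^ 2
        + 2 * ((∑ k ∈ Finset.range n, D k) ω * D n ω)) μ :=
      (hM2 n).integrable_sq.add (hMD.const_mul 2)
    calc ∫ ω, (∑ k ∈ Finset.range (n + 1), D k ω) ^ 2 ∂μ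
        = ∫ ω, ((∑ k ∈ Finset.range n, D k) ω ^ 2
            + 2 * ((∑ k ∈ Finset.range n, D k) ω * D n ω) + D n ω ^ 2) ∂μ := by
          simp only [Finset.sum_range_succ, Finset.sum_apply, add_sq, mul_assoc]
      _ = ∑ k ∈ Finset.range (n + 1), ∫ ω, D k ω ^ 2 ∂μ := by
          rw [integral_add hM2D (hL2 n).integrable_sq,
            integral_add (hM2 n).integrable_sq (hMD.const_mul 2), integral_const_mul, hcross,
            mul_zero, add_zero, Finset.sum_range_succ, ← ih]
          simp only [Finset.sum_apply]

theorem ae_cauchySeq_sum_of_condExp_eq_zero (hD : ∀ n, StronglyMeasurable[ℱ (n + 1)] (D n))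
    (hL2 : ∀ n, MemLp (D n) 2 μ) (hcond : ∀ n, μ[D n | ℱ n] =ᵐ[μ] 0)
    (hsum : Summable fun n => ∫ ω, D n ω ^ 2 ∂μ) :
    ∀ᵐ ω ∂μ, CauchySeq fun n => ∑ k ∈ Finset.range n, D k ω := by
  have hMart := martingale_sum_of_condExp_eq_zero hD (fun n => (hL2 n).integrable one_le_two) hcond
  have hM2 (n : ℕ) : MemLp (∑ k ∈ Finset.range n, D k) 2 μ := memLp_finsetSum' _ fun k _ => hL2 k
  have hL1 (n : ℕ) : ∫ ω, ‖(∑ k ∈ Finset.range n, D k) ω‖ ∂μ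
      ≤ μ.real univ + ∑' k, ∫ ω, D k ω ^ 2 ∂μ :=
    calc ∫ ω, ‖(∑ k ∈ Finset.range n, D k) ω‖ ∂μ
        ≤ ∫ ω, (1 + (∑ k ∈ Finset.range n, D k) ω ^ 2) ∂μ := by
          refine integral_mono (hMart.integrable n).norm
            ((integrable_const _).add (hM2 n).integrable_sq) fun ω => ?_
          rw [Real.norm_eq_abs, ← sq_abs ((∑ k ∈ Finset.range n, D k) ω)]
          nlinarith [sq_nonneg (|(∑ k ∈ Finset.range n, D k) ω| - 1 / 2)]
      _ = μ.real univ + ∑ k ∈ Finset.range n, ∫ ω, D k ω ^ 2 ∂μ := by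
          rw [integral_add (integrable_const _) (hM2 n).integrable_sq, integral_const, smul_eq_mul,
            mul_one, ← integral_sum_sq_of_condExp_eq_zero hD hL2 hcond n]
          simp only [Finset.sum_apply]
      _ ≤ μ.real univ + ∑' k, ∫ ω, D k ω ^ 2 ∂μ := by
          gcongr
          exact hsum.sum_le_tsum _ fun k _ => integral_nonneg fun ω => sq_nonneg _
  have hbdd (n : ℕ) : eLpNorm (∑ k ∈ Finset.range n, D k) 1 μ
      ≤ (μ.real univ + ∑' k, ∫ ω, D k ω ^ 2 ∂μ).toNNReal := by
    rw [eLpNorm_one_eq_lintegral_enorm,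
      ← ofReal_integral_norm_eq_lintegral_enorm (hMart.integrable n)]
    exact ENNReal.ofReal_le_ofReal (hL1 n)
  filter_upwards [hMart.submartingale.exists_ae_tendsto_of_bdd hbdd] with ω ⟨l, hl⟩
  simpa only [Finset.sum_apply] using hl.cauchySeq

theorem ae_cauchySeq_sum_mul_of_condExp_eq_zero {a ξ : ℕ → Ω → ℝ} {c : ℕ → ℝ} {B : ℝ}
    (hc : Summable fun n => c n ^ 2) (ha : ∀ n, StronglyMeasurable[ℱ n] (a n))
    (hac : ∀ n ω, |a n ω| ≤ |c n|) (hξ : ∀ n, StronglyMeasurable[ℱ (n + 1)] (ξ n))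
    (hξB : ∀ n ω, |ξ n ω| ≤ B) (hcond : ∀ n, μ[ξ n | ℱ n] =ᵐ[μ] 0) :
    ∀ᵐ ω ∂μ, CauchySeq fun n => ∑ k ∈ Finset.range n, a k ω * ξ k ω := by
  have hDmeas (n : ℕ) : StronglyMeasurable[ℱ (n + 1)] (a n * ξ n) :=
    ((ha n).mono (ℱ.mono n.le_succ)).mul (hξ n)
  have hDbound (n : ℕ) (ω : Ω) : |(a n * ξ n) ω| ≤ |c n| * B := by
    rw [Pi.mul_apply, abs_mul]
    exact mul_le_mul (hac n ω) (hξB n ω) (abs_nonneg _) (abs_nonneg _)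
  have hDL2 (n : ℕ) : MemLp (a n * ξ n) 2 μ :=
    .of_bound ((hDmeas n).mono (ℱ.le _)).aestronglyMeasurable _ (.of_forall (hDbound n))
  have hξint (n : ℕ) : Integrable (ξ n) μ :=
    .of_bound ((hξ n).mono (ℱ.le _)).aestronglyMeasurable _ (.of_forall (hξB n))
  refine ae_cauchySeq_sum_of_condExp_eq_zero hDmeas hDL2 (fun n => ?_) ?_
  · filter_upwards [condExp_mul_of_stronglyMeasurable_left (ha n)
      ((hDL2 n).integrable one_le_two) (hξint n), hcond n] with ω hω hω0
    exact hω.trans (by rw [Pi.mul_apply, hω0, Pi.zero_apply, mul_zero])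
  · refine .of_nonneg_of_le (fun n => integral_nonneg fun ω => sq_nonneg _) (fun n => ?_)
      ((hc.mul_right (B ^ 2)).mul_left (μ.real univ))
    calc ∫ ω, (a n * ξ n) ω ^ 2 ∂μ ≤ ∫ _, c n ^ 2 * B ^ 2 ∂μ := by
          refine integral_mono (hDL2 n).integrable_sq (integrable_const _) fun ω => ?_
          grw [← sq_abs ((a n * ξ n) ω), hDbound n ω, mul_pow, sq_abs]
      _ = μ.real univ * (c n ^ 2 * B ^ 2) := by rw [integral_const, smul_eq_mul]

end Martingale

theorem measurable_comp_of_continuousOn {Ω X Y : Type*} {_ : MeasurableSpace Ω}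
    [TopologicalSpace X] [MeasurableSpace X] [OpensMeasurableSpace X] [TopologicalSpace Y]
    [MeasurableSpace Y] [BorelSpace Y] {g : X → Y} {s : Set X} (hg : ContinuousOn g s)
    {u : Ω → X} (hu : Measurable u) (hus : ∀ ω, u ω ∈ s) : Measurable fun ω => g (u ω) :=
  (continuousOn_iff_continuous_domRestrict.1 hg).measurable.comp (hu.subtype_mk (h := hus))

theorem exists_measurable_mem_forall_ae_tendsto {Ω E : Type*} {m0 : MeasurableSpace Ω}
    {μ : Measure Ω} [NeZero μ] [TopologicalSpace E] [TopologicalSpace.PseudoMetrizableSpace E]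
    [T2Space E] [MeasurableSpace E] [BorelSpace E] {u : ℕ → Ω → E}
    (hu : ∀ n, Measurable (u n)) {T : Set E} (hT : MeasurableSet T)
    (hlim : ∀ᵐ ω ∂μ, ∃ t ∈ T, Tendsto (fun n => u n ω) atTop (𝓝 t)) :
    ∃ g : Ω → E, Measurable g ∧ (∀ ω, g ω ∈ T) ∧
      ∀ᵐ ω ∂μ, Tendsto (fun n => u n ω) atTop (𝓝 (g ω)) := by
  classical
  obtain ⟨-, t₀, ht₀, -⟩ := hlim.exists
  obtain ⟨g, hg, hgl⟩ := measurable_limit_of_tendsto_metrizable_ae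
    (fun n => (hu n).aemeasurable (μ := μ)) (hlim.mono fun ω ⟨t, _, ht⟩ => ⟨t, ht⟩)
  refine ⟨fun ω => if g ω ∈ T then g ω else t₀,
    .ite (hg hT) hg measurable_const, fun ω => ?_, ?_⟩
  · dsimp only
    split_ifs with h
    exacts [h, ht₀]
  · filter_upwards [hlim, hgl] with ω ⟨t, htT, ht⟩ hgω
    rwa [if_pos (tendsto_nhds_unique hgω ht ▸ htT)]

section Weights

variable {r : ℕ → ℝ}

theorem isEquivalent_one_div_of_tendsto_mul
    (hr : Tendsto (fun n : ℕ => (n : ℝ) * r n) atTop (𝓝 1)) :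
    Asymptotics.IsEquivalent atTop r fun n => 1 / (n : ℝ) := by
  refine Asymptotics.isEquivalent_of_tendsto_one (hr.congr fun n => ?_)
  rw [Pi.div_apply, div_div_eq_mul_div, div_one, mul_comm]

theorem eventually_nonneg_of_tendsto_mul
    (hr : Tendsto (fun n : ℕ => (n : ℝ) * r n) atTop (𝓝 1)) : ∀ᶠ n in atTop, 0 ≤ r n := by
  filter_upwards [hr.eventually_const_lt one_pos] with n hn
  exact (pos_of_mul_pos_right hn n.cast_nonneg).le

theorem summable_sq_of_tendsto_mul
    (hr : Tendsto (fun n : ℕ => (n : ℝ) * r n) atTop (𝓝 1)) : Summable fun n => r n ^ 2 := by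
  refine ((isEquivalent_one_div_of_tendsto_mul hr).pow 2).summable_iff_nat.2 ?_
  simpa only [Pi.pow_def, one_div_pow] using Real.summable_one_div_nat_pow.2 one_lt_two

theorem not_summable_of_tendsto_mul
    (hr : Tendsto (fun n : ℕ => (n : ℝ) * r n) atTop (𝓝 1)) : ¬ Summable r :=
  (isEquivalent_one_div_of_tendsto_mul hr).summable_iff_nat.not.2 Real.not_summable_one_div_natCast

theorem tendsto_zero_of_tendsto_mul
    (hr : Tendsto (fun n : ℕ => (n : ℝ) * r n) atTop (𝓝 1)) : Tendsto r atTop (𝓝 0) :=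
  (isEquivalent_one_div_of_tendsto_mul hr).symm.tendsto_nhds tendsto_one_div_atTop_nhds_zero_nat

end Weights

section Mean

variable {N : ℕ} {z : Fin N → ℝ}

theorem continuous_avg : Continuous (avg : (Fin N → ℝ) → ℝ) := by
  unfold avg
  fun_prop

theorem avg_add (z w : Fin N → ℝ) : avg (z + w) = avg z + avg w := by
  simp only [avg, Pi.add_apply, Finset.sum_add_distrib, add_div]

theorem avg_smul (c : ℝ) (z : Fin N → ℝ) : avg (c • z) = c * avg z := by
  simp only [avg, Pi.smul_apply, smul_eq_mul, ← Finset.mul_sum, mul_div_assoc]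

theorem avg_mono {w : Fin N → ℝ} (h : z ≤ w) : avg z ≤ avg w := by
  unfold avg
  gcongr
  exact h _

variable [NeZero N]

theorem avg_const (t : ℝ) : avg (fun _ : Fin N => t) = t := by
  simp [avg, NeZero.ne]

theorem avg_mem_Icc (hz : z ∈ Icc 0 1) : avg z ∈ Icc (0 : ℝ) 1 :=
  ⟨(avg_const 0).symm.trans_le (avg_mono hz.1), (avg_mono hz.2).trans_eq (avg_const 1)⟩

theorem eq_of_le_of_avg_eq {w : Fin N → ℝ} (h : z ≤ w) (havg : avg z = avg w) : z = w := by
  have hsum : ∑ i, z i = ∑ i, w i := (div_left_inj' (NeZero.ne _)).1 havg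
  exact funext fun i => (Finset.sum_eq_sum_iff_of_le fun i _ => h i).1 hsum i (Finset.mem_univ i)

end Mean

section Field

variable {N : ℕ} {α β q : ℝ} {f : ℝ → ℝ} {z : Fin N → ℝ}

theorem zeroSet_eq_inter_preimage :
    zeroSet N α β q f = Icc 0 1 ∩ field N α β q f ⁻¹' {0} := by
  ext z
  simp only [zeroSet, mem_ofPred_eq, mem_inter_iff, mem_preimage, mem_singleton_iff, mem_Icc,
    Pi.le_def, Pi.zero_apply, Pi.one_apply, forall_and]

theorem continuousOn_field (hf : ContinuousOn f (Icc 0 1)) :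
    ContinuousOn (field N α β q f) (Icc 0 1) := by
  have hfz (h : Fin N) : ContinuousOn (fun z : Fin N → ℝ => f (z h)) (Icc 0 1) :=
    hf.comp (continuous_apply h).continuousOn fun z hz => ⟨hz.1 h, hz.2 h⟩
  have hmean : Continuous fun z : Fin N → ℝ => α * avg z + β * q :=
    (continuous_avg.const_mul α).add_const _
  exact continuousOn_pi.2 fun h =>
    (hmean.continuousOn.add ((hfz h).const_mul _)).sub (continuous_apply h).continuousOn

theorem field_add_mem_Icc [NeZero N] (hα : 0 ≤ α) (hβ : 0 ≤ β) (hαβ' : α + β ≤ 1)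
    (hq : 0 ≤ q) (hq' : q ≤ 1) (hf : MapsTo f (Icc 0 1) (Icc 0 1)) (hz : z ∈ Icc 0 1)
    (h : Fin N) : field N α β q f z h + z h ∈ Icc (0 : ℝ) 1 := by
  obtain ⟨havg0, havg1⟩ := avg_mem_Icc hz
  obtain ⟨hf0, hf1⟩ := hf ⟨hz.1 h, hz.2 h⟩
  have hγ : 0 ≤ 1 - α - β := by linarith
  rw [field, sub_add_cancel]
  refine ⟨by positivity, ?_⟩
  linarith [mul_le_of_le_one_right hα havg1, mul_le_of_le_one_right hβ hq',
    mul_le_of_le_one_right hγ hf1]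

/-- The zeros of `φ` in `[0, 1]`, that is the values `t` of the synchronized zeros `(t, …, t)` of
the field. -/
def syncZeros (α β q : ℝ) (f : ℝ → ℝ) : Set ℝ :=
  {t ∈ Icc 0 1 | syncFun α β q f t = 0}

theorem isClosed_syncZeros (hf : ContinuousOn f (Icc 0 1)) : IsClosed (syncZeros α β q f) := by
  refine ContinuousOn.preimage_isClosed_of_isClosed (f := syncFun α β q f) (t := {0}) ?_
    isClosed_Icc isClosed_singleton
  unfold syncFun
  fun_prop

theorem syncFun_eq_zero_iff (hγ : 1 - α - β ≠ 0) {t : ℝ} :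
    syncFun α β q f t = 0 ↔ (1 - α - β) * f t = (1 - α) * t - β * q := by
  unfold syncFun
  field_simp
  constructor <;> intro h <;> linarith

theorem field_const_eq_zero_iff [NeZero N] (hγ : 1 - α - β ≠ 0) {t : ℝ} :
    field N α β q f (fun _ => t) = 0 ↔ syncFun α β q f t = 0 := by
  simp only [syncFun_eq_zero_iff hγ, funext_iff, field, avg_const, Pi.zero_apply, forall_const]
  constructor <;> intro h <;> linarith

theorem avg_field_eq_zero [NeZero N] (hγ : 1 - α - β ≠ 0)
    (hz : ∀ h, syncFun α β q f (z h) = 0) : avg (field N α β q f z) = 0 := by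
  have hfield : field N α β q f z = (fun _ => α * avg z) + (-α) • z := funext fun h => by
    simp only [field, (syncFun_eq_zero_iff hγ).1 (hz h), Pi.add_apply, Pi.smul_apply, smul_eq_mul]
    ring
  rw [hfield, avg_add, avg_smul, avg_const]
  ring

/-- At a zero of the field all the coordinates are zeros of the function `φ̃` with the common
parameter `c = -(α avg z + β q) / (1 - α - β)`. -/
theorem isSynchronized_of_atMostOneZero [NeZero N] (hγ : 1 - α - β ≠ 0)
    (hz : z ∈ zeroSet N α β q f)
    (hc : AtMostOneZero α β f (-((α * avg z + β * q) / (1 - α - β)))) : IsSynchronized z := by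
  have hroot (h : Fin N) : z h ∈ {x | x ∈ Icc (0 : ℝ) 1 ∧
      f x - 1 / (1 - α - β) * x - -((α * avg z + β * q) / (1 - α - β)) = 0} := by
    refine ⟨hz.1 h, ?_⟩
    have hfield := congrFun hz.2 h
    simp only [field, Pi.zero_apply] at hfield
    field_simp
    linarith
  exact ⟨z 0, hz.1 0, funext fun h => hc (hroot h) (hroot 0)⟩

theorem isSynchronized_of_mem_zeroSet [NeZero N] (hα : 0 ≤ α) (hβ : 0 ≤ β)
    (hαβ : 0 < α + β) (hαβ' : α + β < 1) (hq : 0 < q) (hq' : q ≤ 1)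
    (hc : ∀ c ∈ Ioo (-((α + β) / (1 - α - β))) 0, AtMostOneZero α β f c)
    (hc_end : α = 0 → q = 1 → AtMostOneZero α β f (-((α + β) / (1 - α - β))))
    (hz : z ∈ zeroSet N α β q f) : IsSynchronized z := by
  have hγ : 0 < 1 - α - β := by linarith
  have hz01 : z ∈ Icc 0 1 := (zeroSet_eq_inter_preimage.subset hz).1
  obtain ⟨havg0, havg1⟩ := avg_mem_Icc hz01
  have hsync := isSynchronized_of_atMostOneZero hγ.ne' hz
  have hαz : α * avg z ≤ α := mul_le_of_le_one_right hα havg1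
  have hβq : β * q ≤ β := mul_le_of_le_one_right hβ hq'
  have hαz0 : 0 ≤ α * avg z := mul_nonneg hα havg0
  have hβq0 : 0 ≤ β * q := mul_nonneg hβ hq.le
  rcases (add_nonneg hαz0 hβq0).eq_or_lt with h0 | h0
  · obtain rfl : β = 0 := (mul_eq_zero.1 (show β * q = 0 by linarith)).resolve_right hq.ne'
    have havg : avg z = 0 := (mul_eq_zero.1 (show α * avg z = 0 by linarith)).resolve_left
      (by linarith)
    exact ⟨0, by simp, (eq_of_le_of_avg_eq hz01.1 ((avg_const 0).trans havg.symm)).symm⟩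
  rcases (add_le_add hαz hβq).eq_or_lt with h1 | h1
  · by_cases hα0 : α = 0
    · have hq1 : q = 1 := mul_left_cancel₀ (show β ≠ 0 by linarith) (by linarith)
      exact hsync (h1 ▸ hc_end hα0 hq1)
    · have havg : avg z = 1 := mul_left_cancel₀ hα0 (by linarith)
      exact ⟨1, by simp, eq_of_le_of_avg_eq hz01.2 (havg.trans (avg_const 1).symm)⟩
  · refine hsync (hc _ ⟨?_, ?_⟩)
    · rw [neg_lt_neg_iff]
      gcongr
    · rw [neg_lt_zero]
      positivity

end Field

section Potential

variable {N : ℕ} {α β q : ℝ} {f : ℝ → ℝ} {z w : Fin N → ℝ}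

/-- A potential of the mean field: its gradient is `-F`. -/
noncomputable def potential (N : ℕ) (α β q : ℝ) (f : ℝ → ℝ) (z : Fin N → ℝ) : ℝ :=
  (z ⬝ᵥ z) / 2 - β * q * ∑ h, z h - α / (2 * N) * (∑ h, z h) ^ 2
    - (1 - α - β) * ∑ h, ∫ x in 0..z h, f x

theorem field_dotProduct (v : Fin N → ℝ) : field N α β q f z ⬝ᵥ v =
    (α * avg z + β * q) * ∑ h, v h + (1 - α - β) * ((f ∘ z) ⬝ᵥ v) - z ⬝ᵥ v := by
  simp only [dotProduct, field, Function.comp_apply, Finset.mul_sum,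
    ← Finset.sum_add_distrib, ← Finset.sum_sub_distrib]
  exact Finset.sum_congr rfl fun h _ => by ring

/-- Only the summand `½ |z| ^ 2` of the potential is not concave. -/
theorem potential_le (hα : 0 ≤ α) (hαβ' : α + β ≤ 1) (hf : MonotoneOn f (Icc 0 1))
    (hz : z ∈ Icc 0 1) (hw : w ∈ Icc 0 1) :
    potential N α β q f w ≤ potential N α β q f z - field N α β q f z ⬝ᵥ (w - z)
      + 1 / 2 * ((w - z) ⬝ᵥ (w - z)) := by
  have hint {t : ℝ} (ht : t ∈ Icc (0 : ℝ) 1) : IntervalIntegrable f volume 0 t :=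
    (hf.mono (uIcc_subset_Icc ⟨le_rfl, zero_le_one⟩ ht)).intervalIntegrable
  have hprim : (f ∘ z) ⬝ᵥ (w - z) ≤ ∑ h, (∫ x in 0..w h, f x) - ∑ h, ∫ x in 0..z h, f x := by
    rw [← Finset.sum_sub_distrib]
    refine Finset.sum_le_sum fun h _ => ?_
    have hzh : z h ∈ Icc (0 : ℝ) 1 := ⟨hz.1 h, hz.2 h⟩
    have hwh : w h ∈ Icc (0 : ℝ) 1 := ⟨hw.1 h, hw.2 h⟩
    rw [intervalIntegral.integral_interval_sub_left (hint hwh) (hint hzh)]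
    exact mul_sub_le_integral_of_monotoneOn ordConnected_Icc hf hzh hwh
  have hprimγ := mul_le_mul_of_nonneg_left hprim (show 0 ≤ 1 - α - β by linarith)
  have hmean : 0 ≤ α / (2 * N) * (∑ h, w h - ∑ h, z h) ^ 2 := by positivity
  have hquad : (w - z) ⬝ᵥ (w - z) = w ⬝ᵥ w - z ⬝ᵥ z - 2 * (z ⬝ᵥ (w - z)) := by
    simp only [sub_dotProduct, dotProduct_sub, dotProduct_comm w z]
    ring
  have havg : α * avg z = 2 * (α / (2 * N)) * ∑ h, z h := by unfold avg; ring
  rw [field_dotProduct, hquad, havg]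
  simp only [potential, Pi.sub_apply, Finset.sum_sub_distrib]
  linarith

theorem exists_forall_le_potential (hf : ContinuousOn f (Icc 0 1)) :
    ∃ b, ∀ z ∈ Icc 0 1, b ≤ potential N α β q f z := by
  have hprim : ContinuousOn (fun t => ∫ x in 0..t, f x) (Icc 0 1) := by
    rw [← uIcc_of_le (zero_le_one' ℝ)] at hf ⊢
    exact intervalIntegral.continuousOn_primitive_interval hf.integrableOn_uIcc
  have hprimz (h : Fin N) :
      ContinuousOn (fun z : Fin N → ℝ => ∫ x in 0..z h, f x) (Icc 0 1) :=
    hprim.comp (continuous_apply h).continuousOn fun z hz => ⟨hz.1 h, hz.2 h⟩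
  have hcont : ContinuousOn (potential N α β q f) (Icc 0 1) := by
    unfold potential dotProduct
    fun_prop
  obtain ⟨b, hb⟩ := (isCompact_Icc.image_of_continuousOn hcont).bddBelow
  exact ⟨b, fun z hz => hb (mem_image_of_mem _ hz)⟩

end Potential

section Synchronization

variable {N : ℕ} [NeZero N] {α β q : ℝ} {f : ℝ → ℝ} {x ξ : ℕ → Fin N → ℝ} {r : ℕ → ℝ}

theorem tendsto_sub_avg_of_tendsto_nhdsSet_zeroSet
    (hsync : ∀ z ∈ zeroSet N α β q f, IsSynchronized z)
    (hx : Tendsto x atTop (𝓝ˢ (zeroSet N α β q f))) (h : Fin N) :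
    Tendsto (fun n => x n h - avg (x n)) atTop (𝓝 0) := by
  have hcont : Continuous fun z : Fin N → ℝ => z h - avg z :=
    (continuous_apply h).sub continuous_avg
  rw [← nhdsSet_singleton]
  refine (hcont.tendsto_nhdsSet fun z hz => ?_).comp hx
  obtain ⟨t, -, rfl⟩ := hsync z hz
  exact sub_eq_zero.2 (avg_const t).symm

theorem tendsto_nhdsSet_syncZeros_of_tendsto_nhdsSet_zeroSet (hγ : 1 - α - β ≠ 0)
    (hsync : ∀ z ∈ zeroSet N α β q f, IsSynchronized z)
    (hx : Tendsto x atTop (𝓝ˢ (zeroSet N α β q f))) (h : Fin N) :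
    Tendsto (fun n => x n h) atTop (𝓝ˢ (syncZeros α β q f)) := by
  refine ((continuous_apply h).tendsto_nhdsSet fun z hz => ?_).comp hx
  obtain ⟨t, ht, rfl⟩ := hsync z hz
  exact ⟨ht, (field_const_eq_zero_iff hγ).1 hz.2⟩

/-- On an interval of zeros of `φ` the function `f` is affine and the mean of the field vanishes;
an interval without zeros of `φ` is eventually avoided by the coordinates of `x n`. -/
theorem exists_Icc_eventually_avg_field_eq_zero (hγ : 1 - α - β ≠ 0)
    (hf : ContinuousOn f (Icc 0 1)) {y : ℕ → ℝ}
    (hxT : ∀ h, Tendsto (fun n => x n h) atTop (𝓝ˢ (syncZeros α β q f)))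
    (hxy : ∀ h, Tendsto (fun n => x n h - y n) atTop (𝓝 0)) {s t : ℝ} (hst : s < t) :
    ∃ a b, s ≤ a ∧ a < b ∧ b ≤ t ∧
      ∀ᶠ n in atTop, y n ∈ Icc a b → avg (field N α β q f (x n)) = 0 := by
  obtain ⟨a, b, hsa, hab, hbt, hT⟩ :=
    exists_Icc_subset_or_subset_compl_of_isClosed
      (isClosed_syncZeros (α := α) (β := β) (q := q) hf) hst
  obtain ⟨ε, hε, hεab⟩ : ∃ ε > 0, a + ε < b - ε := ⟨(b - a) / 3, by linarith, by linarith⟩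
  have hclose : ∀ᶠ n in atTop, y n ∈ Icc (a + ε) (b - ε) → ∀ h, x n h ∈ Icc a b := by
    filter_upwards [eventually_all.2 fun h => (hxy h).eventually_mem
      (Ioo_mem_nhds (neg_lt_zero.2 hε) hε)] with n hn hy h
    constructor <;> linarith [(hn h).1, (hn h).2, hy.1, hy.2]
  refine ⟨a + ε, b - ε, by linarith, hεab, by linarith, ?_⟩
  rcases hT with hT | hT
  · exact hclose.mono fun n hn hy => avg_field_eq_zero hγ fun h => (hT (hn hy h)).2
  · filter_upwards [hclose, (hxT 0).eventually
      (isClosed_Icc.isOpen_compl.mem_nhdsSet.2 (subset_compl_comm.1 hT))] with n hn hn0 hy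
    exact absurd (hn hy 0) hn0

theorem mem_syncZeros_of_tendsto_const (hγ : 1 - α - β ≠ 0) (hf : ContinuousOn f (Icc 0 1))
    (hx : ∀ n, x n ∈ Icc 0 1)
    (hF : Tendsto (fun n => field N α β q f (x n)) atTop (𝓝 0)) {t : ℝ}
    (ht : Tendsto x atTop (𝓝 fun _ => t)) : t ∈ syncZeros α β q f := by
  have hmem : (fun _ => t : Fin N → ℝ) ∈ Icc 0 1 :=
    isClosed_Icc.mem_of_tendsto ht (.of_forall hx)
  have hFt := (continuousOn_field (α := α) (β := β) (q := q) hf _ hmem).tendsto.comp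
    (tendsto_nhdsWithin_iff.2 ⟨ht, .of_forall hx⟩)
  exact ⟨⟨hmem.1 0, hmem.2 0⟩, (field_const_eq_zero_iff hγ).1 (tendsto_nhds_unique hFt hF)⟩

/-- Subtracting the accumulated noise from the mean of the coordinates leaves a sequence `y` which
only moves by `r n` times the mean of the field, hence does not oscillate. -/
theorem exists_tendsto_const_of_tendsto_field_zero (hγ : 1 - α - β ≠ 0)
    (hf : ContinuousOn f (Icc 0 1)) (hsync : ∀ z ∈ zeroSet N α β q f, IsSynchronized z)
    (hx : ∀ n, x n ∈ Icc 0 1) (hr : Tendsto r atTop (𝓝 0))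
    (hstep : ∀ n, x (n + 1) = x n + r n • (field N α β q f (x n) + ξ n))
    (hξ : CauchySeq fun n => ∑ k ∈ Finset.range n, r k • ξ k)
    (hF : Tendsto (fun n => field N α β q f (x n)) atTop (𝓝 0)) :
    ∃ t ∈ syncZeros α β q f, Tendsto x atTop (𝓝 fun _ => t) := by
  have hxz : Tendsto x atTop (𝓝ˢ (zeroSet N α β q f)) :=
    zeroSet_eq_inter_preimage ▸
      tendsto_nhdsSet_inter_preimage isCompact_Icc (continuousOn_field hf) hx hF
  obtain ⟨S, hS⟩ := cauchySeq_tendsto_of_complete hξ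
  set y : ℕ → ℝ := fun n => avg (x n) + (avg S - avg (∑ k ∈ Finset.range n, r k • ξ k)) with hy
  have hystep (n : ℕ) : y (n + 1) = y n + r n * avg (field N α β q f (x n)) := by
    simp only [hy, hstep, Finset.sum_range_succ, avg_add, avg_smul]
    ring
  have hnoise : Tendsto (fun n => avg S - avg (∑ k ∈ Finset.range n, r k • ξ k)) atTop (𝓝 0) :=
    sub_self (avg S) ▸ ((continuous_avg.tendsto S).comp hS).const_sub (avg S)
  have hxy (h : Fin N) : Tendsto (fun n => x n h - y n) atTop (𝓝 0) := by
    simpa only [hy, sub_add_eq_sub_sub, sub_zero] using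
      (tendsto_sub_avg_of_tendsto_nhdsSet_zeroSet hsync hxz h).sub hnoise
  have hbdd : Bornology.IsBounded (range y) :=
    ((Metric.isBounded_Icc 0 1).sub (Metric.isBounded_range_of_tendsto _ (hxy 0))).subset <|
      range_subset_iff.2 fun n => sub_sub_cancel (x n 0) (y n) ▸
        sub_mem_sub ⟨(hx n).1 0, (hx n).2 0⟩ (mem_range_self n)
  have hdrift : Tendsto (fun n => y (n + 1) - y n) atTop (𝓝 0) := by
    simpa only [hystep, add_sub_cancel_left, zero_mul, Function.comp_def] using
      hr.mul ((continuous_avg.tendsto _).comp hF)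
  obtain ⟨t, ht⟩ := exists_tendsto_of_forall_exists_barrier hbdd hdrift fun s t hst => by
    obtain ⟨a, b, hsa, hab, hbt, hstuck⟩ := exists_Icc_eventually_avg_field_eq_zero hγ hf
      (tendsto_nhdsSet_syncZeros_of_tendsto_nhdsSet_zeroSet hγ hsync hxz) hxy hst
    refine ⟨a, b, hsa, hab, hbt, hstuck.mono fun n hn hyn => ?_⟩
    rw [hystep, hn hyn, mul_zero, add_zero]
  have hxt : Tendsto x atTop (𝓝 fun _ => t) := tendsto_pi_nhds.2 fun h => by
    simpa only [sub_add_cancel, zero_add] using (hxy h).add ht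
  exact ⟨t, mem_syncZeros_of_tendsto_const hγ hf hx hF hxt, hxt⟩

theorem exists_tendsto_const_of_cauchySeq_noise (hα : 0 ≤ α) (hαβ' : α + β < 1)
    (hf_mono : MonotoneOn f (Icc 0 1)) (hf : ContinuousOn f (Icc 0 1))
    (hsync : ∀ z ∈ zeroSet N α β q f, IsSynchronized z)
    (hr : Tendsto (fun n : ℕ => (n : ℝ) * r n) atTop (𝓝 1)) (hx : ∀ n, x n ∈ Icc 0 1)
    (hstep : ∀ n, x (n + 1) = x n + r n • (field N α β q f (x n) + ξ n))
    (hbound : ∀ n h, |(field N α β q f (x n) + ξ n) h| ≤ 1)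
    (hξ : CauchySeq fun n => ∑ k ∈ Finset.range n, r k • ξ k)
    (hFξ : CauchySeq fun n => ∑ k ∈ Finset.range n, r k * (field N α β q f (x k) ⬝ᵥ ξ k)) :
    ∃ t ∈ syncZeros α β q f, Tendsto x atTop (𝓝 fun _ => t) := by
  have hr0 := eventually_nonneg_of_tendsto_mul hr
  obtain ⟨b, hb⟩ := exists_forall_le_potential (N := N) (α := α) (β := β) (q := q) hf
  have hdrift : Summable fun n => r n * (field N α β q f (x n) ⬝ᵥ field N α β q f (x n)) :=
    summable_mul_dotProduct_self_of_lyapunov one_half_pos.le hb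
      (fun z hz w hw => potential_le hα hαβ'.le hf_mono hz hw) hx hr0
      (summable_sq_of_tendsto_mul hr) hstep (fun n => dotProduct_self_le_card (hbound n)) hFξ
  have hdrift' : Summable fun n => r n * ‖field N α β q f (x n)‖ ^ 2 := by
    refine .of_norm_bounded_eventually_nat hdrift (hr0.mono fun n hn => ?_)
    rw [Real.norm_of_nonneg (by positivity)]
    gcongr
    exact norm_sq_le_dotProduct_self _
  have hF := tendsto_field_zero_of_summable_mul_norm_sq
    (isCompact_Icc.uniformContinuousOn_of_continuous (continuousOn_field hf)) hx hr0
    (not_summable_of_tendsto_mul hr) hstep hdrift' hξ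
  exact exists_tendsto_const_of_tendsto_field_zero (by linarith) hf hsync hx
    (tendsto_zero_of_tendsto_mul hr) hstep hξ hF

end Synchronization

section System

variable {Ω : Type*} [m0 : MeasurableSpace Ω] {μ : Measure Ω} {N : ℕ} {α β q : ℝ}
  {f : ℝ → ℝ} {r : ℕ → ℝ} {I Z : ℕ → Fin N → Ω → ℝ}

/-- The filtration `past I Z`, to which the system is adapted. -/
def IsSystem.filtration (hsys : IsSystem μ α β q f r I Z) : Filtration ℕ m0 where
  seq := past I Z
  mono' _ _ hmn := sup_le_sup le_rfl (biSup_mono fun _ hk => Icc_subset_Icc_right hmn hk)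
  le' n := by
    refine sup_le (iSup_le fun h => (hsys.measurable_init h).comap_le)
      (iSup₂_le fun k hk => iSup_le fun h => ?_)
    obtain ⟨j, rfl⟩ := Nat.exists_eq_add_of_le' hk.1
    exact (hsys.measurable_action j h).comap_le

theorem IsSystem.measurable_filtration_action (hsys : IsSystem μ α β q f r I Z) (n : ℕ)
    (h : Fin N) : Measurable[hsys.filtration (n + 1)] (I (n + 1) h) :=
  measurable_iff_comap_le.2 <| le_sup_of_le_right <|
    le_iSup₂_of_le (n + 1) ⟨n.succ_pos, le_rfl⟩ <|
      le_iSup (fun h => MeasurableSpace.comap (I (n + 1) h) inferInstance) h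

theorem IsSystem.measurable_filtration_state (hsys : IsSystem μ α β q f r I Z) (n : ℕ)
    (h : Fin N) : Measurable[hsys.filtration n] (Z n h) := by
  induction n with
  | zero =>
    exact measurable_iff_comap_le.2 <| le_sup_of_le_left <|
      le_iSup (fun h => MeasurableSpace.comap (Z 0 h) inferInstance) h
  | succ n ih =>
    have hZ : Measurable[hsys.filtration (n + 1)] (Z n h) :=
      ih.mono (hsys.filtration.mono n.le_succ) le_rfl
    rw [show Z (n + 1) h = fun ω => (1 - r n) * Z n h ω + r n * I (n + 1) h ω from
      funext (hsys.dynamics n h)]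
    exact (hZ.const_mul _).add ((hsys.measurable_filtration_action n h).const_mul _)

theorem IsSystem.state_mem_Icc (hsys : IsSystem μ α β q f r I Z) (n : ℕ) (ω : Ω) :
    (Z n · ω) ∈ Icc 0 1 :=
  ⟨fun h => (hsys.state_mem n h ω).1, fun h => (hsys.state_mem n h ω).2⟩

theorem IsSystem.measurable_filtration_field (hsys : IsSystem μ α β q f r I Z)
    (hf : ContinuousOn f (Icc 0 1)) (n : ℕ) (h : Fin N) :
    Measurable[hsys.filtration n] fun ω => field N α β q f (Z n · ω) h :=
  measurable_comp_of_continuousOn (continuousOn_pi.1 (continuousOn_field hf) h)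
    (@measurable_pi_lambda _ _ _ (hsys.filtration n) _ _ (hsys.measurable_filtration_state n))
    (hsys.state_mem_Icc n)

theorem IsSystem.action_mem_Icc (hsys : IsSystem μ α β q f r I Z) (n : ℕ) (h : Fin N) (ω : Ω) :
    I (n + 1) h ω ∈ Icc (0 : ℝ) 1 := by
  rcases hsys.action_mem n h ω with hI | hI <;> simp [hI]

theorem IsSystem.condExp_action (hsys : IsSystem μ α β q f r I Z) (n : ℕ) (h : Fin N) :
    μ[I (n + 1) h | hsys.filtration n] =ᵐ[μ] fun ω => field N α β q f (Z n · ω) h + Z n h ω := by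
  have hI : I (n + 1) h = (I (n + 1) h ⁻¹' {1}).indicator fun _ => (1 : ℝ) := by
    funext ω
    rcases hsys.action_mem n h ω with h0 | h0 <;> simp [indicator, h0]
  rw [hI]
  simp only [field, sub_add_cancel]
  exact hsys.condProb n h

/-- The martingale differences `I (n + 1) h - P(I (n + 1) h = 1 | past I Z n)` driving the
system. -/
noncomputable def noise (α β q : ℝ) (f : ℝ → ℝ) (I Z : ℕ → Fin N → Ω → ℝ) (n : ℕ) (ω : Ω) :
    Fin N → ℝ :=
  fun h => I (n + 1) h ω - (field N α β q f (Z n · ω) h + Z n h ω)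

theorem IsSystem.state_succ (hsys : IsSystem μ α β q f r I Z) (n : ℕ) (ω : Ω) :
    (Z (n + 1) · ω) =
      (Z n · ω) + r n • (field N α β q f (Z n · ω) + noise α β q f I Z n ω) := by
  funext h
  simp only [hsys.dynamics, noise, Pi.add_apply, Pi.smul_apply, smul_eq_mul]
  ring

theorem IsSystem.abs_field_add_noise_le_one (hsys : IsSystem μ α β q f r I Z) (n : ℕ) (ω : Ω)
    (h : Fin N) : |(field N α β q f (Z n · ω) + noise α β q f I Z n ω) h| ≤ 1 := by
  have hI := hsys.action_mem_Icc n h ω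
  have hZ := hsys.state_mem n h ω
  rw [Pi.add_apply, noise, abs_le]
  constructor <;> linarith [hI.1, hI.2, hZ.1, hZ.2]

theorem IsSystem.stronglyMeasurable_noise (hsys : IsSystem μ α β q f r I Z)
    (hf : ContinuousOn f (Icc 0 1)) (n : ℕ) (h : Fin N) :
    StronglyMeasurable[hsys.filtration (n + 1)] fun ω => noise α β q f I Z n ω h :=
  ((hsys.measurable_filtration_action n h).sub
    (((hsys.measurable_filtration_field hf n h).add (hsys.measurable_filtration_state n h)).mono
      (hsys.filtration.mono n.le_succ) le_rfl)).stronglyMeasurable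

theorem IsSystem.condExp_noise [IsFiniteMeasure μ] (hsys : IsSystem μ α β q f r I Z)
    (hf : ContinuousOn f (Icc 0 1)) (n : ℕ) (h : Fin N) :
    μ[fun ω => noise α β q f I Z n ω h | hsys.filtration n] =ᵐ[μ] 0 := by
  have hact := hsys.condExp_action n h
  have hIint : Integrable (I (n + 1) h) μ :=
    .of_mem_Icc 0 1 (hsys.measurable_action n h).aemeasurable
      (.of_forall (hsys.action_mem_Icc n h))
  have hpint : Integrable (fun ω => field N α β q f (Z n · ω) h + Z n h ω) μ :=
    integrable_condExp.congr hact
  have hpmeas : StronglyMeasurable[hsys.filtration n]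
      fun ω => field N α β q f (Z n · ω) h + Z n h ω :=
    ((hsys.measurable_filtration_field hf n h).add
      (hsys.measurable_filtration_state n h)).stronglyMeasurable
  filter_upwards [condExp_sub hIint hpint (hsys.filtration n), hact] with ω hsub hω
  refine hsub.trans ?_
  rw [Pi.sub_apply, hω, condExp_of_stronglyMeasurable (hsys.filtration.le n) hpmeas hpint,
    sub_self, Pi.zero_apply]

variable [NeZero N] [IsFiniteMeasure μ]

theorem IsSystem.ae_cauchySeq_sum_mul_noise (hsys : IsSystem μ α β q f r I Z) (hα : 0 ≤ α)
    (hβ : 0 ≤ β) (hαβ' : α + β ≤ 1) (hq : 0 ≤ q) (hq' : q ≤ 1)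
    (hf_mem : MapsTo f (Icc 0 1) (Icc 0 1)) (hf : ContinuousOn f (Icc 0 1)) {a : ℕ → Ω → ℝ}
    (ha : ∀ n, StronglyMeasurable[hsys.filtration n] (a n)) (har : ∀ n ω, |a n ω| ≤ |r n|)
    (h : Fin N) :
    ∀ᵐ ω ∂μ, CauchySeq fun n => ∑ k ∈ Finset.range n, a k ω * noise α β q f I Z k ω h := by
  refine ae_cauchySeq_sum_mul_of_condExp_eq_zero (B := 1)
    (summable_sq_of_tendsto_mul hsys.weights) ha har (hsys.stronglyMeasurable_noise hf · h)
    (fun n ω => ?_) (hsys.condExp_noise hf · h)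
  have hI := hsys.action_mem_Icc n h ω
  have hp := field_add_mem_Icc hα hβ hαβ' hq hq' hf_mem (hsys.state_mem_Icc n ω) h
  rw [noise, abs_le]
  constructor <;> linarith [hI.1, hI.2, hp.1, hp.2]

theorem IsSystem.ae_exists_tendsto_const (hsys : IsSystem μ α β q f r I Z) (hα : 0 ≤ α)
    (hβ : 0 ≤ β) (hαβ' : α + β < 1) (hq : 0 ≤ q) (hq' : q ≤ 1)
    (hf_mem : MapsTo f (Icc 0 1) (Icc 0 1)) (hf_mono : MonotoneOn f (Icc 0 1))
    (hf : ContinuousOn f (Icc 0 1)) (hsync : ∀ z ∈ zeroSet N α β q f, IsSynchronized z) :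
    ∀ᵐ ω ∂μ, ∃ t ∈ syncZeros α β q f,
      Tendsto (fun n => (Z n · ω)) atTop (𝓝 fun _ => t) := by
  have hnoise {a : ℕ → Ω → ℝ} (ha : ∀ n, StronglyMeasurable[hsys.filtration n] (a n))
      (har : ∀ n ω, |a n ω| ≤ |r n|) (h : Fin N) :=
    hsys.ae_cauchySeq_sum_mul_noise hα hβ hαβ'.le hq hq' hf_mem hf ha har h
  have hξ : ∀ᵐ ω ∂μ, ∀ h, CauchySeq fun n =>
      ∑ k ∈ Finset.range n, r k * noise α β q f I Z k ω h :=
    ae_all_iff.2 <| hnoise (fun _ => stronglyMeasurable_const) fun _ _ => le_rfl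
  have hFξ : ∀ᵐ ω ∂μ, ∀ h, CauchySeq fun n => ∑ k ∈ Finset.range n,
      r k * field N α β q f (Z k · ω) h * noise α β q f I Z k ω h := by
    refine ae_all_iff.2 fun h => hnoise (a := fun n ω => r n * field N α β q f (Z n · ω) h)
      (fun n => ((hsys.measurable_filtration_field hf n h).const_mul _).stronglyMeasurable)
      (fun n ω => ?_) h
    have hp := field_add_mem_Icc hα hβ hαβ'.le hq hq' hf_mem (hsys.state_mem_Icc n ω) h
    have hZ := hsys.state_mem n h ω
    rw [abs_mul]
    refine mul_le_of_le_one_right (abs_nonneg _) (abs_le.2 ?_)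
    constructor <;> linarith [hp.1, hp.2, hZ.1, hZ.2]
  filter_upwards [hξ, hFξ] with ω hξω hFξω
  refine exists_tendsto_const_of_cauchySeq_noise hα hαβ' hf_mono hf hsync hsys.weights
    (hsys.state_mem_Icc · ω) (hsys.state_succ · ω) (hsys.abs_field_add_noise_le_one · ω) ?_ ?_
  · choose l hl using fun h => cauchySeq_tendsto_of_complete (hξω h)
    refine (tendsto_pi_nhds.2 fun h => (hl h).congr fun n => ?_).cauchySeq
    simp only [Finset.sum_apply, Pi.smul_apply, smul_eq_mul]
  · choose l hl using fun h => cauchySeq_tendsto_of_complete (hFξω h)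
    refine ((tendsto_finsetSum Finset.univ fun h _ => hl h).congr fun n => ?_).cauchySeq
    rw [Finset.sum_comm]
    simp only [dotProduct, Finset.mul_sum, mul_assoc]

end System

end ReinforcedSync

open ReinforcedSync in
theorem theorem2p2_general {Ω : Type*} [MeasurableSpace Ω] (μ : Measure Ω)
    [IsProbabilityMeasure μ] (N : ℕ) [NeZero N] (α β q : ℝ) (hα : 0 ≤ α) (hβ : 0 ≤ β)
    (hαβ : 0 < α + β) (hαβ' : α + β < 1) (hq : 0 < q) (hq' : q ≤ 1)
    (f : ℝ → ℝ) (hf_mem : MapsTo f (Icc 0 1) (Icc 0 1)) (hf_mono : MonotoneOn f (Icc 0 1))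
    (hf : ContinuousOn f (Icc 0 1)) (r : ℕ → ℝ) (I Z : ℕ → Fin N → Ω → ℝ)
    (hsys : IsSystem μ α β q f r I Z)
    (hc : ∀ c ∈ Ioo (-((α + β) / (1 - α - β))) 0, AtMostOneZero α β f c)
    (hc_end : α = 0 → q = 1 → AtMostOneZero α β f (-((α + β) / (1 - α - β)))) :
    (∀ z ∈ zeroSet N α β q f, IsSynchronized z) ∧
    ∃ Zinf : Ω → ℝ, Measurable Zinf ∧
      (∀ ω, Zinf ω ∈ Icc (0 : ℝ) 1 ∧ syncFun α β q f (Zinf ω) = 0) ∧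
      ∀ᵐ ω ∂μ, Tendsto (fun n => fun h => Z n h ω) atTop (𝓝 (fun _ => Zinf ω)) := by
  have hsync : ∀ z ∈ zeroSet N α β q f, IsSynchronized z := fun z =>
    isSynchronized_of_mem_zeroSet hα hβ hαβ hαβ' hq hq' hc hc_end
  have hlim := hsys.ae_exists_tendsto_const hα hβ hαβ' hq.le hq' hf_mem hf_mono hf hsync
  obtain ⟨Zinf, hmeas, hmem, hZinf⟩ := exists_measurable_mem_forall_ae_tendsto (u := fun n => Z n 0)
    (fun n => (hsys.measurable_filtration_state n 0).mono (hsys.filtration.le n) le_rfl)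
    (isClosed_syncZeros hf).measurableSet
    (hlim.mono fun ω ⟨t, ht, hZt⟩ => ⟨t, ht, tendsto_pi_nhds.1 hZt 0⟩)
  refine ⟨hsync, Zinf, hmeas, hmem, ?_⟩
  filter_upwards [hlim, hZinf] with ω ⟨t, _, hZt⟩ hω
  rwa [tendsto_nhds_unique hω (tendsto_pi_nhds.1 hZt 0)]

theorem theorem2p2 {Ω : Type*} [MeasurableSpace Ω] (μ : Measure Ω) [IsProbabilityMeasure μ]
    (N : ℕ) (hN : 2 ≤ N) (α β q : ℝ) (hα : 0 ≤ α) (hβ : 0 ≤ β) (hαβ : 0 < α + β)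
    (hαβ' : α + β < 1) (hq : 0 < q) (hq' : q ≤ 1)
    (f : ℝ → ℝ) (hf_mem : MapsTo f (Icc 0 1) (Icc 0 1)) (hf_mono : StrictMonoOn f (Icc 0 1))
    (hf_diff : ContDiffOn ℝ 1 f (Icc 0 1))
    (r : ℕ → ℝ) (I Z : ℕ → Fin N → Ω → ℝ)
    (hsys : ReinforcedSync.IsSystem μ α β q f r I Z)
    (hfin : {z | z ∈ ReinforcedSync.zeroSet N α β q f ∧
      ReinforcedSync.IsSynchronized z}.Finite)
    (hprim : ∃ G : ℝ → ℝ, ∀ x ∈ Icc (0 : ℝ) 1, HasDerivWithinAt G (f x) (Icc 0 1) x)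
    (hc : ∀ c ∈ Ioo (-((α + β) / (1 - α - β))) 0, ReinforcedSync.AtMostOneZero α β f c)
    (hc_end : α = 0 → q = 1 → ReinforcedSync.AtMostOneZero α β f (-((α + β) / (1 - α - β)))) :
    (∀ z ∈ ReinforcedSync.zeroSet N α β q f, ReinforcedSync.IsSynchronized z) ∧
    ∃ Zinf : Ω → ℝ, Measurable Zinf ∧
      (∀ ω, Zinf ω ∈ Icc (0 : ℝ) 1 ∧ ReinforcedSync.syncFun α β q f (Zinf ω) = 0) ∧
      ∀ᵐ ω ∂μ, Tendsto (fun n => fun h => Z n h ω) atTop (𝓝 (fun _ => Zinf ω)) := by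
  have : NeZero N := ⟨by omega⟩
  exact theorem2p2_general μ N α β q hα hβ hαβ hαβ' hq hq' f hf_mem hf_mono.monotoneOn
    hf_diff.continuousOn r I Z hsys hc hc_end
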